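/- Let $n\ge 1$ and let $\Omega\subset\mathbb{R}^n$ be a nonempty bounded open set (in particular, $\Omega$ may be any bounded domain). Let $H^1(\Omega)$ be the space of $u\in L^2(\Omega)$ with weak gradient $\nabla u\in L^2(\Omega)^n$, and let $H_0^1(\Omega)$ be the closure in $H^1(\Omega)$ of the smooth functions with compact support in $\Omega$. Call $\lambda\in\mathbb{R}$ an eigenvalue if there is $\varphi\in H_0^1(\Omega)$, $\varphi\neq 0$, with $$\int_\Omega \nabla \varphi\cdot\nabla v\,dx=\lambda\int_\Omega \varphi v\,dx\qquad\text{for all } v\in H_0^1(\Omega).$$ Then there is a smallest eigenvalue $\lambda_1$ (the first Dirichlet eigenvalue of $-\Delta$ on $\Omega$), and $\lambda_1>0$. Moreover, for every real $p$ and every weak solution $u\in H_0^1(\Omega)$ of $$-\Delta u=u^p\ \text{ in }\Omega,\qquad u>0\ \text{ in }\Omega,\qquad u=0\ \text{ on }\partial\Omega,$$ that is, every $u\in H_0^1(\Omega)$ such that $u>0$ a.e. in $\Omega$ and, for all $v\in H_0^1(\Omega)$, $u^pv$ is integrable on $\Omega$ with $$\int_\Omega \nabla u\cdot\nabla v\,dx=\int_\Omega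 u^p v\,dx,$$ one has $$\operatorname*{ess\,sup}_{x\in\Omega} u(x)^{p-1}\ \ge\ \lambda_1 ,$$ where the essential supremum is taken in $(-\infty,+\infty]$. -/

import Mathlib

open MeasureTheory Filter Topology
open scoped ContDiff

/-- The test functions on `Ω`: smooth, with compact support contained in `Ω`. -/
structure IsTestFunction {n : ℕ} (Ω : Set (EuclideanSpace ℝ (Fin n)))
    (φ : EuclideanSpace ℝ (Fin n) → ℝ) : Prop where
  smooth : ContDiff ℝ ∞ φ
  compact_supp : HasCompactSupport φ
  supp_subset : tsupport φ ⊆ Ω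

/-- `g` is a weak (distributional) gradient of `u` on `Ω`. -/
structure HasWeakGradient {n : ℕ} (Ω : Set (EuclideanSpace ℝ (Fin n)))
    (u : EuclideanSpace ℝ (Fin n) → ℝ)
    (g : EuclideanSpace ℝ (Fin n) → EuclideanSpace ℝ (Fin n)) : Prop where
  locInt : LocallyIntegrableOn u Ω volume
  locInt_grad : LocallyIntegrableOn g Ω volume
  parts : ∀ φ : EuclideanSpace ℝ (Fin n) → ℝ, IsTestFunction Ω φ →
    ∫ x in Ω, u x • gradient φ x = -∫ x in Ω, φ x • g x

/-- `u` belongs to the Sobolev space `H¹(Ω)` and `g` is its weak gradient.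
Functions are represented by functions on the whole space; only their values almost everywhere
on `Ω` matter. -/
structure IsH1 {n : ℕ} (Ω : Set (EuclideanSpace ℝ (Fin n)))
    (u : EuclideanSpace ℝ (Fin n) → ℝ)
    (g : EuclideanSpace ℝ (Fin n) → EuclideanSpace ℝ (Fin n)) : Prop where
  memLp : MemLp u 2 (volume.restrict Ω)
  memLp_grad : MemLp g 2 (volume.restrict Ω)
  weakGradient : HasWeakGradient Ω u g

/-- `u` belongs to `H₀¹(Ω)`, the closure of the test functions in `H¹(Ω)`, and `g` is its weak
gradient. -/
structure IsH10 {n : ℕ} (Ω : Set (EuclideanSpace ℝ (Fin n)))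
    (u : EuclideanSpace ℝ (Fin n) → ℝ)
    (g : EuclideanSpace ℝ (Fin n) → EuclideanSpace ℝ (Fin n)) : Prop where
  isH1 : IsH1 Ω u g
  approx : ∃ φ : ℕ → EuclideanSpace ℝ (Fin n) → ℝ, (∀ k, IsTestFunction Ω (φ k)) ∧
    Tendsto (fun k => eLpNorm (fun x => φ k x - u x) 2 (volume.restrict Ω)) atTop (𝓝 0) ∧
    Tendsto (fun k => eLpNorm (fun x => gradient (φ k) x - g x) 2 (volume.restrict Ω))
      atTop (𝓝 0)

/-- `lam` is an eigenvalue of the problem `(∇u, ∇v) = lam (u, v)` for all `v ∈ H₀¹(Ω)`, with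
`u ∈ H₀¹(Ω)` nonzero. -/
def IsDirichletEigenvalue {n : ℕ} (Ω : Set (EuclideanSpace ℝ (Fin n))) (lam : ℝ) : Prop :=
  ∃ (u : EuclideanSpace ℝ (Fin n) → ℝ)
    (g : EuclideanSpace ℝ (Fin n) → EuclideanSpace ℝ (Fin n)),
    IsH10 Ω u g ∧ ¬ (u =ᵐ[volume.restrict Ω] 0) ∧
      ∀ (v : EuclideanSpace ℝ (Fin n) → ℝ)
        (h : EuclideanSpace ℝ (Fin n) → EuclideanSpace ℝ (Fin n)), IsH10 Ω v h →
        ∫ x in Ω, inner ℝ (g x) (h x) = lam * ∫ x in Ω, u x * v x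

/-- The first (smallest) Dirichlet eigenvalue. -/
noncomputable def firstDirichletEigenvalue {n : ℕ} (Ω : Set (EuclideanSpace ℝ (Fin n))) : ℝ :=
  sInf {lam : ℝ | IsDirichletEigenvalue Ω lam}

/-- `u ∈ H₀¹(Ω)` is a weak solution of `-Δu = u ^ p`, `u > 0` in `Ω`, `u = 0` on `∂Ω`:
`u > 0` a.e. in `Ω` and `(∇u, ∇v) = ∫ u ^ p v` for all `v ∈ H₀¹(Ω)`, the right-hand side being
a convergent integral. -/
def IsPositiveWeakSolution {n : ℕ} (Ω : Set (EuclideanSpace ℝ (Fin n))) (p : ℝ)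
    (u : EuclideanSpace ℝ (Fin n) → ℝ) : Prop :=
  (∀ᵐ x ∂(volume.restrict Ω), 0 < u x) ∧
    ∃ g : EuclideanSpace ℝ (Fin n) → EuclideanSpace ℝ (Fin n), IsH10 Ω u g ∧
      ∀ (v : EuclideanSpace ℝ (Fin n) → ℝ)
        (h : EuclideanSpace ℝ (Fin n) → EuclideanSpace ℝ (Fin n)), IsH10 Ω v h →
        IntegrableOn (fun x => u x ^ p * v x) Ω volume ∧
          ∫ x in Ω, inner ℝ (g x) (h x) = ∫ x in Ω, u x ^ p * v x

/-! Test the equation for `u` with `u` itself: `∫ |∇u|² = ∫ u^p u = ∫ u^(p-1) u²`. If `u^(p-1) ≤ q`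
a.e. with `q < λ₁`, the right side is at most `q ∫ u²`, while the Rayleigh inequality bounds the
left side below by `λ₁ ∫ u²`. Since `∫ u² > 0`, this is a contradiction. No restriction on `p` is
needed.

The substance is that the Rayleigh quotient attains a positive minimum on `H₀¹(Ω)`, at an
eigenfunction (`exists_eigenvalue_rayleigh`); testing any other eigenvalue equation with its own
eigenfunction shows that this minimum is the least eigenvalue. Everything is done with test
functions and then passes to `H₀¹` by density. The abstract `exists_rayleigh_minimizer` needs
coercivity, which is Poincaré's inequality (`norm_testToLp_le`), and compactness, which is Rellich's
theorem (`exists_subseq_tendsto_testToLp`). The latter compares functions with their averages over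
small balls: these are uniformly close in `L²` when the gradients are bounded, and averaging turns
weak convergence into strong convergence. -/

/-! ### Minimizing an abstract Rayleigh quotient -/

theorem linear_coeff_eq_zero_of_quadratic_nonneg {a b : ℝ}
    (h : ∀ t : ℝ, 0 ≤ 2 * t * a + t ^ 2 * b) : a = 0 := by
  by_contra ha
  have hb : 0 ≤ b := by nlinarith [h 1, h (-1)]
  -- The vertex would be `-a / b`; the shift by one also covers `b = 0` and still gives a negative
  -- value.
  have h1 := h (-a / (b + 1))
  have hb1 : 0 < b + 1 := by linarith
  have : 2 * (-a / (b + 1)) * a + (-a / (b + 1)) ^ 2 * b = -(a ^ 2 * (b + 2)) / (b + 1) ^ 2 := by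
    field_simp
    ring
  rw [this] at h1
  have h2 : 0 < a ^ 2 * (b + 2) / (b + 1) ^ 2 := by positivity
  rw [neg_div] at h1
  linarith

/-- A coercive quotient `‖G v‖² / ‖J v‖²` with compact `J` attains its infimum in the completion. -/
theorem exists_rayleigh_minimizer {V X Y : Type*} [AddCommGroup V] [Module ℝ V]
    [NormedAddCommGroup X] [InnerProductSpace ℝ X]
    [NormedAddCommGroup Y] [InnerProductSpace ℝ Y] [CompleteSpace Y]
    (J : V →ₗ[ℝ] X) (G : V →ₗ[ℝ] Y) {C : ℝ} (hCpos : 0 < C) (hC : ∀ v, ‖J v‖ ≤ C * ‖G v‖)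
    (hJ : ∃ v, J v ≠ 0)
    (hcomp : ∀ (v : ℕ → V) (M : ℝ), (∀ k, ‖G (v k)‖ ≤ M) →
      ∃ σ : ℕ → ℕ, StrictMono σ ∧ ∃ x, Tendsto (fun k => J (v (σ k))) atTop (𝓝 x)) :
    ∃ lam : ℝ, 0 < lam ∧ (∀ w, lam * ‖J w‖ ^ 2 ≤ ‖G w‖ ^ 2) ∧
      ∃ (v : ℕ → V) (x : X) (y : Y), Tendsto (fun k => J (v k)) atTop (𝓝 x) ∧
        Tendsto (fun k => G (v k)) atTop (𝓝 y) ∧ ‖x‖ = 1 ∧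
        ∀ w, inner ℝ y (G w) = lam * inner ℝ x (J w) := by
  set S : Set ℝ := (fun v => ‖G v‖ ^ 2) '' {v | ‖J v‖ = 1} with hS
  have hSlow : ∀ s ∈ S, (1 / C) ^ 2 ≤ s := by
    rintro _ ⟨v, hv, rfl⟩
    have h1 := hC v
    rw [hv] at h1
    have : 1 / C ≤ ‖G v‖ := by
      rw [div_le_iff₀ hCpos]; linarith
    exact pow_le_pow_left₀ (by positivity) this 2
  have hSbdd : BddBelow S := ⟨_, hSlow⟩
  have hSne : S.Nonempty := by
    obtain ⟨v, hv⟩ := hJ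
    refine ⟨_, ‖J v‖⁻¹ • v, ?_, rfl⟩
    simp [norm_smul, hv]
  set lam := sInf S with hlam
  have hpos : 0 < lam := lt_of_lt_of_le (by positivity) (le_csInf hSne hSlow)
  have hray : ∀ w, lam * ‖J w‖ ^ 2 ≤ ‖G w‖ ^ 2 := by
    intro w
    by_cases hw : J w = 0
    · simp [hw]
    have hw' : 0 < ‖J w‖ := norm_pos_iff.mpr hw
    have h1 : lam ≤ ‖G (‖J w‖⁻¹ • w)‖ ^ 2 :=
      csInf_le hSbdd ⟨_, by simp [norm_smul, hw], rfl⟩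
    rw [map_smul, norm_smul, norm_inv, norm_norm, mul_pow, inv_pow,
      ← div_eq_inv_mul, le_div_iff₀ (by positivity)] at h1
    exact h1
  refine ⟨lam, hpos, hray, ?_⟩
  have hseq : ∀ k : ℕ, ∃ v, ‖J v‖ = 1 ∧ ‖G v‖ ^ 2 < lam + 1 / ((k : ℝ) + 1) := by
    intro k
    obtain ⟨_, ⟨v, hv, rfl⟩, h⟩ := exists_lt_of_csInf_lt hSne
      (show sInf S < lam + 1 / ((k : ℝ) + 1) from lt_add_of_pos_right _ (by positivity))
    exact ⟨v, hv, h⟩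
  choose v hv1 hv2 using hseq
  -- A crude bound from `s ≤ s² + 1`, enough for compactness.
  have hGb : ∀ k, ‖G (v k)‖ ≤ lam + 1 + 1 := by
    intro k
    have h1 : 1 / ((k : ℝ) + 1) ≤ 1 := by
      rw [div_le_one (by positivity)]; linarith [(k.cast_nonneg : (0 : ℝ) ≤ k)]
    nlinarith [hv2 k, norm_nonneg (G (v k)), sq_nonneg (‖G (v k)‖ - 1)]
  obtain ⟨σ, hσ, x, hx⟩ := hcomp v _ hGb
  have hGsq : Tendsto (fun k => ‖G (v (σ k))‖ ^ 2) atTop (𝓝 lam) := by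
    have h1 : Tendsto (fun k => ‖G (v k)‖ ^ 2) atTop (𝓝 lam) := by
      refine tendsto_of_tendsto_of_tendsto_of_le_of_le tendsto_const_nhds
        (h := fun k : ℕ => lam + 1 / ((k : ℝ) + 1)) ?_ (fun k => ?_) (fun k => (hv2 k).le)
      · simpa using tendsto_const_nhds.add (tendsto_one_div_add_atTop_nhds_zero_nat (𝕜 := ℝ))
      · simpa [hv1] using hray (v k)
    exact h1.comp hσ.tendsto_atTop
  -- The parallelogram law in both spaces, with the Rayleigh bound applied to the sum of two members
  -- of the minimizing sequence. The right side tends to zero, so the images under `G` converge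
  -- strongly and not just weakly.
  have hdist : ∀ k l, ‖G (v (σ k)) - G (v (σ l))‖ ^ 2 ≤
      2 * ‖G (v (σ k))‖ ^ 2 + 2 * ‖G (v (σ l))‖ ^ 2 - 4 * lam
        + lam * ‖J (v (σ k)) - J (v (σ l))‖ ^ 2 := by
    intro k l
    have p1 := parallelogram_law_with_norm ℝ (G (v (σ k))) (G (v (σ l)))
    have p2 := parallelogram_law_with_norm ℝ (J (v (σ k))) (J (v (σ l)))
    have h := hray (v (σ k) + v (σ l))
    rw [map_add, map_add] at h
    rw [hv1, hv1] at p2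
    have p3 : ‖J (v (σ k)) + J (v (σ l))‖ ^ 2 = 4 - ‖J (v (σ k)) - J (v (σ l))‖ ^ 2 := by
      nlinarith
    rw [p3] at h
    nlinarith
  have hcauchy : CauchySeq fun k => G (v (σ k)) := by
    rw [cauchySeq_iff_tendsto_dist_atTop_0]
    have hJ0 : Tendsto (fun q : ℕ × ℕ => ‖J (v (σ q.1)) - J (v (σ q.2))‖ ^ 2) atTop (𝓝 0) := by
      have := cauchySeq_iff_tendsto_dist_atTop_0.mp hx.cauchySeq
      simpa [dist_eq_norm] using this.pow 2
    have h1 : Tendsto (fun q : ℕ × ℕ => ‖G (v (σ q.1))‖ ^ 2) atTop (𝓝 lam) := by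
      rw [← prod_atTop_atTop_eq]; exact hGsq.comp tendsto_fst
    have h2 : Tendsto (fun q : ℕ × ℕ => ‖G (v (σ q.2))‖ ^ 2) atTop (𝓝 lam) := by
      rw [← prod_atTop_atTop_eq]; exact hGsq.comp tendsto_snd
    have h3 := (((h1.const_mul 2).add (h2.const_mul 2)).sub_const (4 * lam)).add
      (hJ0.const_mul lam)
    have h4 : Tendsto (fun q : ℕ × ℕ => ‖G (v (σ q.1)) - G (v (σ q.2))‖ ^ 2) atTop (𝓝 0) := by
      refine squeeze_zero (fun _ => by positivity) (fun q => hdist q.1 q.2) ?_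
      convert h3 using 2
      ring
    have h5 := h4.sqrt
    simpa [dist_eq_norm, Real.sqrt_sq] using h5
  obtain ⟨y, hy⟩ := cauchySeq_tendsto_of_complete hcauchy
  have hx1 : ‖x‖ = 1 := by
    have := hx.norm
    simp only [hv1] at this
    exact (tendsto_nhds_unique this tendsto_const_nhds)
  have hy1 : ‖y‖ ^ 2 = lam := tendsto_nhds_unique (hy.norm.pow 2) hGsq
  refine ⟨fun k => v (σ k), x, y, hx, hy, hx1, fun w => ?_⟩
  rw [← sub_eq_zero]
  refine linear_coeff_eq_zero_of_quadratic_nonneg (b := ‖G w‖ ^ 2 - lam * ‖J w‖ ^ 2) fun t => ?_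
  -- First variation: the Rayleigh bound survives in the limit, with equality at `t = 0`, so the
  -- term linear in `t` must vanish.
  have h1 : lam * ‖x + t • J w‖ ^ 2 ≤ ‖y + t • G w‖ ^ 2 := by
    refine le_of_tendsto_of_tendsto' (((hx.add_const (t • J w)).norm.pow 2).const_mul lam)
      ((hy.add_const (t • G w)).norm.pow 2) fun k => ?_
    simpa using hray (v (σ k) + t • w)
  rw [norm_add_sq_real, norm_add_sq_real, hx1, hy1, inner_smul_right, inner_smul_right,
    norm_smul, norm_smul, mul_pow, mul_pow, Real.norm_eq_abs, sq_abs] at h1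
  nlinarith

/-! ### Test functions, `H₀¹` as a closure, and the Poincaré inequality -/

section

theorem MeasureTheory.MemLp.inner_toLp_toLp {α F : Type*} [MeasurableSpace α] {μ : Measure α}
    [NormedAddCommGroup F] [InnerProductSpace ℝ F] {f g : α → F}
    (hf : MemLp f 2 μ) (hg : MemLp g 2 μ) :
    inner ℝ (hf.toLp f) (hg.toLp g) = ∫ x, inner ℝ (f x) (g x) ∂μ := by
  rw [L2.inner_def]
  refine integral_congr_ae ?_
  filter_upwards [hf.coeFn_toLp, hg.coeFn_toLp] with x h1 h2
  rw [h1, h2]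

theorem MeasureTheory.MemLp.norm_toLp_sq {α F : Type*} [MeasurableSpace α] {μ : Measure α}
    [NormedAddCommGroup F] [InnerProductSpace ℝ F] {f : α → F} (hf : MemLp f 2 μ) :
    ‖hf.toLp f‖ ^ 2 = ∫ x, ‖f x‖ ^ 2 ∂μ := by
  rw [← real_inner_self_eq_norm_sq, hf.inner_toLp_toLp hf]
  simp

namespace IsTestFunction

variable {n : ℕ} {Ω : Set (EuclideanSpace ℝ (Fin n))} {φ ψ : EuclideanSpace ℝ (Fin n) → ℝ}

theorem contDiff_one (hφ : IsTestFunction Ω φ) : ContDiff ℝ 1 φ :=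
  hφ.smooth.of_le (by norm_cast)

theorem differentiable (hφ : IsTestFunction Ω φ) : Differentiable ℝ φ :=
  hφ.contDiff_one.differentiable one_ne_zero

theorem continuous (hφ : IsTestFunction Ω φ) : Continuous φ := hφ.smooth.continuous

theorem continuous_gradient (hφ : IsTestFunction Ω φ) : Continuous (gradient φ) :=
  (InnerProductSpace.toDual ℝ _).symm.continuous.comp
    (hφ.contDiff_one.continuous_fderiv one_ne_zero)

theorem hasCompactSupport_gradient (hφ : IsTestFunction Ω φ) :
    HasCompactSupport (gradient φ) :=
  (hφ.compact_supp.fderiv (𝕜 := ℝ)).comp_left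
    (g := (InnerProductSpace.toDual ℝ (EuclideanSpace ℝ (Fin n))).symm) (map_zero _)

theorem memLp (hφ : IsTestFunction Ω φ) : MemLp φ 2 (volume.restrict Ω) :=
  (hφ.continuous.memLp_of_hasCompactSupport hφ.compact_supp).restrict Ω

theorem memLp_gradient (hφ : IsTestFunction Ω φ) :
    MemLp (gradient φ) 2 (volume.restrict Ω) :=
  (hφ.continuous_gradient.memLp_of_hasCompactSupport hφ.hasCompactSupport_gradient).restrict Ω

theorem eq_zero_of_notMem (hφ : IsTestFunction Ω φ) {x : EuclideanSpace ℝ (Fin n)}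
    (hx : x ∉ Ω) : φ x = 0 :=
  image_eq_zero_of_notMem_tsupport fun h => hx (hφ.supp_subset h)

theorem gradient_eq_zero_of_notMem (hφ : IsTestFunction Ω φ) {x : EuclideanSpace ℝ (Fin n)}
    (hx : x ∉ Ω) : gradient φ x = 0 := by
  have : fderiv ℝ φ x = 0 := by
    by_contra h
    exact hx (hφ.supp_subset (support_fderiv_subset ℝ h))
  simp [gradient, this]

theorem add (hφ : IsTestFunction Ω φ) (hψ : IsTestFunction Ω ψ) : IsTestFunction Ω (φ + ψ) where
  smooth := hφ.smooth.add hψ.smooth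
  compact_supp := hφ.compact_supp.add hψ.compact_supp
  supp_subset := (tsupport_add φ ψ).trans (Set.union_subset hφ.supp_subset hψ.supp_subset)

theorem zero : IsTestFunction Ω 0 where
  smooth := contDiff_const
  compact_supp := HasCompactSupport.zero
  supp_subset := by simp [tsupport]

theorem smul (c : ℝ) (hφ : IsTestFunction Ω φ) : IsTestFunction Ω (c • φ) where
  smooth := contDiff_const.smul hφ.smooth
  compact_supp := hφ.compact_supp.smul_left (f := fun _ => c)
  supp_subset := (tsupport_smul_subset_right (fun _ => c) φ).trans hφ.supp_subset

theorem gradient_add (hφ : IsTestFunction Ω φ) (hψ : IsTestFunction Ω ψ) :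
    gradient (φ + ψ) = gradient φ + gradient ψ := by
  ext1 x
  simp [gradient, fderiv_add (hφ.differentiable x) (hψ.differentiable x)]

theorem gradient_smul (c : ℝ) (hφ : IsTestFunction Ω φ) :
    gradient (c • φ) = c • gradient φ := by
  ext1 x
  simp [gradient, fderiv_const_smul (hφ.differentiable x)]

theorem integral_smul_gradient (hφ : IsTestFunction Ω φ) (hψ : IsTestFunction Ω ψ) :
    ∫ x in Ω, φ x • gradient ψ x = -∫ x in Ω, ψ x • gradient φ x := by
  rw [setIntegral_eq_integral_of_forall_compl_eq_zero
      fun x hx => by rw [hφ.eq_zero_of_notMem hx, zero_smul],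
    setIntegral_eq_integral_of_forall_compl_eq_zero
      fun x hx => by rw [hψ.eq_zero_of_notMem hx, zero_smul]]
  have i1 : Integrable fun x => φ x • gradient ψ x :=
    (hφ.continuous.smul hψ.continuous_gradient).integrable_of_hasCompactSupport
      hφ.compact_supp.smul_right
  have i2 : Integrable fun x => ψ x • gradient φ x :=
    (hψ.continuous.smul hφ.continuous_gradient).integrable_of_hasCompactSupport
      hψ.compact_supp.smul_right
  refine ext_inner_left ℝ fun v => ?_
  rw [inner_neg_right, ← integral_inner i1, ← integral_inner i2]
  simp only [inner_smul_right, inner_gradient_right, conj_trivial]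
  rw [integral_mul_fderiv_eq_neg_fderiv_mul_of_integrable]
  · simp only [mul_comm]
  · simpa [inner_smul_right, inner_gradient_right, mul_comm] using i2.const_inner (𝕜 := ℝ) v
  · simpa [inner_smul_right, inner_gradient_right] using i1.const_inner (𝕜 := ℝ) v
  · exact (hφ.continuous.mul hψ.continuous).integrable_of_hasCompactSupport
      hφ.compact_supp.mul_right
  · exact fun x _ => hφ.differentiable x
  · exact fun x _ => hψ.differentiable x

end IsTestFunction

variable {n : ℕ}

/-- The test functions on `Ω` as a vector space. -/
def testFunctions (Ω : Set (EuclideanSpace ℝ (Fin n))) :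
    Submodule ℝ (EuclideanSpace ℝ (Fin n) → ℝ) where
  carrier := {φ | IsTestFunction Ω φ}
  add_mem' := IsTestFunction.add
  zero_mem' := IsTestFunction.zero
  smul_mem' c _ h := h.smul c

/-- The embedding of the test functions into `L²(Ω)`. -/
noncomputable def testToLp (Ω : Set (EuclideanSpace ℝ (Fin n))) :
    testFunctions Ω →ₗ[ℝ] Lp ℝ 2 (volume.restrict Ω) where
  toFun φ := φ.2.memLp.toLp φ.1
  map_add' φ ψ := MemLp.toLp_add φ.2.memLp ψ.2.memLp
  map_smul' c φ := MemLp.toLp_const_smul c φ.2.memLp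

/-- The gradient from the test functions to `L²(Ω)ⁿ`. -/
noncomputable def testGradient (Ω : Set (EuclideanSpace ℝ (Fin n))) :
    testFunctions Ω →ₗ[ℝ] Lp (EuclideanSpace ℝ (Fin n)) 2 (volume.restrict Ω) where
  toFun φ := φ.2.memLp_gradient.toLp (gradient φ.1)
  map_add' φ ψ := by
    rw [← MemLp.toLp_add φ.2.memLp_gradient ψ.2.memLp_gradient]
    exact MemLp.toLp_congr _ _ (.of_eq (φ.2.gradient_add ψ.2))
  map_smul' c φ := by
    rw [RingHom.id_apply, ← MemLp.toLp_const_smul c φ.2.memLp_gradient]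
    exact MemLp.toLp_congr _ _ (.of_eq (φ.2.gradient_smul c))

variable {Ω : Set (EuclideanSpace ℝ (Fin n))} {u : EuclideanSpace ℝ (Fin n) → ℝ}
  {g : EuclideanSpace ℝ (Fin n) → EuclideanSpace ℝ (Fin n)}

theorem IsH10.exists_testFunctions_tendsto (h : IsH10 Ω u g) :
    ∃ φ : ℕ → testFunctions Ω,
      Tendsto (fun k => testToLp Ω (φ k)) atTop (𝓝 (h.isH1.memLp.toLp u)) ∧
      Tendsto (fun k => testGradient Ω (φ k)) atTop (𝓝 (h.isH1.memLp_grad.toLp g)) := by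
  obtain ⟨φ, hφ, h1, h2⟩ := h.approx
  exact ⟨fun k => ⟨φ k, hφ k⟩,
    (Lp.tendsto_Lp_iff_tendsto_eLpNorm'' φ (fun k => (hφ k).memLp) u h.isH1.memLp).mpr h1,
    (Lp.tendsto_Lp_iff_tendsto_eLpNorm'' (fun k => gradient (φ k))
      (fun k => (hφ k).memLp_gradient) g h.isH1.memLp_grad).mpr h2⟩

/-- Paired with a fixed vector `v`, each side is an `L²` inner product against a fixed element, so
the classical integration by parts for `φ k` passes to the limit. -/
theorem integral_smul_gradient_eq_of_tendsto
    (hu : MemLp u 2 (volume.restrict Ω)) (hg : MemLp g 2 (volume.restrict Ω))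
    {φ : ℕ → testFunctions Ω}
    (h1 : Tendsto (fun k => testToLp Ω (φ k)) atTop (𝓝 (hu.toLp u)))
    (h2 : Tendsto (fun k => testGradient Ω (φ k)) atTop (𝓝 (hg.toLp g)))
    {ψ : EuclideanSpace ℝ (Fin n) → ℝ} (hψ : IsTestFunction Ω ψ) :
    ∫ x in Ω, u x • gradient ψ x = -∫ x in Ω, ψ x • g x := by
  have integrable_smul {a : EuclideanSpace ℝ (Fin n) → ℝ}
      {b : EuclideanSpace ℝ (Fin n) → EuclideanSpace ℝ (Fin n)}
      (ha : MemLp a 2 (volume.restrict Ω)) (hb : MemLp b 2 (volume.restrict Ω)) :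
      Integrable (fun x => a x • b x) (volume.restrict Ω) :=
    memLp_one_iff_integrable.mp (hb.smul ha)
  refine ext_inner_left ℝ fun v => ?_
  have m1 : MemLp (fun x => inner ℝ v (gradient ψ x)) 2 (volume.restrict Ω) :=
    hψ.memLp_gradient.const_inner v
  have m2 : MemLp (fun x => ψ x • v) 2 (volume.restrict Ω) :=
    ((hψ.continuous.smul continuous_const).memLp_of_hasCompactSupport
      hψ.compact_supp.smul_right).restrict Ω
  have e1 : ∀ (a : EuclideanSpace ℝ (Fin n) → ℝ) (ha : MemLp a 2 (volume.restrict Ω)),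
      inner ℝ v (∫ x in Ω, a x • gradient ψ x) = inner ℝ (m1.toLp _) (ha.toLp a) := by
    intro a ha
    rw [← integral_inner (integrable_smul ha hψ.memLp_gradient), m1.inner_toLp_toLp ha]
    simp [inner_smul_right]
  have e2 : ∀ (b : EuclideanSpace ℝ (Fin n) → EuclideanSpace ℝ (Fin n))
      (hb : MemLp b 2 (volume.restrict Ω)),
      inner ℝ v (∫ x in Ω, ψ x • b x) = inner ℝ (m2.toLp _) (hb.toLp b) := by
    intro b hb
    rw [← integral_inner (integrable_smul hψ.memLp hb), m2.inner_toLp_toLp hb]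
    simp [inner_smul_right, real_inner_smul_left]
  rw [inner_neg_right, e1 u hu, e2 g hg]
  refine tendsto_nhds_unique (tendsto_const_nhds.inner h1)
    (((tendsto_const_nhds.inner h2).neg).congr fun k => ?_)
  have := congrArg (inner ℝ v) ((φ k).2.integral_smul_gradient hψ)
  rw [inner_neg_right, e1 _ (φ k).2.memLp, e2 _ (φ k).2.memLp_gradient] at this
  exact this.symm

theorem isH10_of_tendsto
    (hu : MemLp u 2 (volume.restrict Ω)) (hg : MemLp g 2 (volume.restrict Ω))
    {φ : ℕ → testFunctions Ω}
    (h1 : Tendsto (fun k => testToLp Ω (φ k)) atTop (𝓝 (hu.toLp u)))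
    (h2 : Tendsto (fun k => testGradient Ω (φ k)) atTop (𝓝 (hg.toLp g))) : IsH10 Ω u g where
  isH1 :=
    { memLp := hu
      memLp_grad := hg
      weakGradient :=
        { locInt := locallyIntegrableOn_of_locallyIntegrable_restrict
            (hu.locallyIntegrable one_le_two)
          locInt_grad := locallyIntegrableOn_of_locallyIntegrable_restrict
            (hg.locallyIntegrable one_le_two)
          parts := fun _ => integral_smul_gradient_eq_of_tendsto hu hg h1 h2 } }
  approx := ⟨fun k => (φ k).1, fun k => (φ k).2,
    (Lp.tendsto_Lp_iff_tendsto_eLpNorm'' _ (fun k => (φ k).2.memLp) u hu).mp h1,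
    (Lp.tendsto_Lp_iff_tendsto_eLpNorm'' (fun k => gradient (φ k).1)
      (fun k => (φ k).2.memLp_gradient) g hg).mp h2⟩

/-- Integration by parts of `φ²` against the linear function `l`, whose derivative along `e` is one.
-/
theorem IsTestFunction.integral_sq_eq {φ : EuclideanSpace ℝ (Fin n) → ℝ}
    (hφ : IsTestFunction Ω φ) {e : EuclideanSpace ℝ (Fin n)}
    {l : EuclideanSpace ℝ (Fin n) →L[ℝ] ℝ} (hle : l e = 1) :
    Integrable (fun x => 2 * (φ x * inner ℝ (gradient φ x) e) * l x) ∧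
      ∫ x, φ x ^ 2 = -∫ x, 2 * (φ x * inner ℝ (gradient φ x) e) * l x := by
  have hd : ∀ x, fderiv ℝ (fun y => φ y * φ y) x e = 2 * (φ x * inner ℝ (gradient φ x) e) := by
    intro x
    rw [fderiv_fun_mul (hφ.differentiable x) (hφ.differentiable x), inner_gradient_left]
    simp
    ring
  have cf : Continuous fun x => (inner ℝ (gradient φ x) e : ℝ) :=
    hφ.continuous_gradient.inner (𝕜 := ℝ) continuous_const
  have i1 : Integrable fun x => φ x * φ x :=
    (hφ.continuous.mul hφ.continuous).integrable_of_hasCompactSupport hφ.compact_supp.mul_right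
  have i2 : Integrable fun x => φ x * φ x * l x :=
    ((hφ.continuous.mul hφ.continuous).mul l.continuous).integrable_of_hasCompactSupport
      hφ.compact_supp.mul_right.mul_right
  have i3 : Integrable fun x => 2 * (φ x * inner ℝ (gradient φ x) e) * l x :=
    ((continuous_const.mul (hφ.continuous.mul cf)).mul
      l.continuous).integrable_of_hasCompactSupport
      (hφ.compact_supp.mul_right.mul_left.mul_right)
  refine ⟨i3, ?_⟩
  have := integral_mul_fderiv_eq_neg_fderiv_mul_of_integrable (𝕜 := ℝ) (μ := volume)
    (f := fun y => φ y * φ y) (g := l) (v := e) (by simpa only [hd] using i3)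
    (by simpa only [ContinuousLinearMap.fderiv, hle, mul_one] using i1) i2
    (fun x _ => (hφ.differentiable x).mul (hφ.differentiable x))
    (fun x _ => l.differentiableAt)
  simp only [hd, ContinuousLinearMap.fderiv, hle, mul_one] at this
  simpa only [sq] using this

theorem Continuous.integrable_norm_sq_of_hasCompactSupport {F : Type*} [NormedAddCommGroup F]
    {f : EuclideanSpace ℝ (Fin n) → F} (hf : Continuous f) (hc : HasCompactSupport f) :
    Integrable fun x => ‖f x‖ ^ 2 :=
  (hf.memLp_of_hasCompactSupport hc (p := 2)).integrable_norm_pow two_ne_zero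

theorem exists_unit_coordinate (hn : n ≠ 0) : ∃ (e : EuclideanSpace ℝ (Fin n))
    (l : EuclideanSpace ℝ (Fin n) →L[ℝ] ℝ), ‖e‖ = 1 ∧ l e = 1 ∧ ∀ x, |l x| ≤ ‖x‖ := by
  have : NeZero n := ⟨hn⟩
  have he : ‖(EuclideanSpace.single 0 1 : EuclideanSpace ℝ (Fin n))‖ = 1 := by simp
  refine ⟨EuclideanSpace.single 0 1, innerSL ℝ (EuclideanSpace.single 0 1), he, ?_, fun x => ?_⟩
  · rw [innerSL_apply_apply, real_inner_self_eq_norm_sq, he, one_pow]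
  · rw [innerSL_apply_apply]
    simpa only [he, one_mul] using
      abs_real_inner_le_norm (EuclideanSpace.single 0 1 : EuclideanSpace ℝ (Fin n)) x

theorem IsTestFunction.integral_sq_le {φ : EuclideanSpace ℝ (Fin n) → ℝ}
    (hφ : IsTestFunction Ω φ) (hn : 1 ≤ n) {R : ℝ} (hΩ : ∀ x ∈ Ω, ‖x‖ ≤ R) :
    ∫ x, φ x ^ 2 ≤ 4 * R ^ 2 * ∫ x, ‖gradient φ x‖ ^ 2 := by
  obtain ⟨e, l, he, hle, hl⟩ := exists_unit_coordinate (Nat.pos_iff_ne_zero.mp hn)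
  obtain ⟨i3, key⟩ := hφ.integral_sq_eq hle
  have i1 : Integrable fun x => φ x ^ 2 := by
    simpa only [Real.norm_eq_abs, sq_abs] using
      hφ.continuous.integrable_norm_sq_of_hasCompactSupport hφ.compact_supp
  have i2 : Integrable fun x => ‖gradient φ x‖ ^ 2 :=
    hφ.continuous_gradient.integrable_norm_sq_of_hasCompactSupport hφ.hasCompactSupport_gradient
  -- Young's inequality, weighted so that half of `∫ φ²` can be absorbed on the left; doubling `2 *
  -- R ^ 2` then gives the constant `4 * R ^ 2`.
  have hpt : ∀ x, -(2 * (φ x * inner ℝ (gradient φ x) e) * l x) ≤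
      2⁻¹ * φ x ^ 2 + 2 * R ^ 2 * ‖gradient φ x‖ ^ 2 := by
    intro x
    by_cases hx : x ∈ Ω
    · have b1 : |inner ℝ (gradient φ x) e| ≤ ‖gradient φ x‖ := by
        simpa [he] using abs_real_inner_le_norm (gradient φ x) e
      have b3 : |inner ℝ (gradient φ x) e| * |l x| ≤ R * ‖gradient φ x‖ := by
        rw [mul_comm R]
        exact mul_le_mul b1 ((hl x).trans (hΩ x hx)) (abs_nonneg _) (norm_nonneg _)
      calc _ ≤ |2 * (φ x * inner ℝ (gradient φ x) e) * l x| := neg_le_abs _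
        _ = 2 * |φ x| * (|inner ℝ (gradient φ x) e| * |l x|) := by
          rw [abs_mul, abs_mul, abs_mul, abs_two]; ring
        _ ≤ 2 * |φ x| * (R * ‖gradient φ x‖) := by gcongr
        _ ≤ _ := by
          rw [← sq_abs (φ x)]
          nlinarith [sq_nonneg (|φ x| - 2 * (R * ‖gradient φ x‖))]
    · rw [hφ.eq_zero_of_notMem hx]
      have : 0 ≤ 2 * R ^ 2 * ‖gradient φ x‖ ^ 2 := by positivity
      linarith
  have h := integral_mono i3.neg ((i1.const_mul 2⁻¹).add (i2.const_mul (2 * R ^ 2))) hpt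
  have h1 := integral_add (i1.const_mul 2⁻¹) (i2.const_mul (2 * R ^ 2))
  have h2 := integral_neg (μ := volume) fun x => 2 * (φ x * inner ℝ (gradient φ x) e) * l x
  rw [integral_const_mul, integral_const_mul] at h1
  simp only [Pi.add_apply, Pi.neg_apply] at h
  linarith

/-- The **Poincaré inequality** for test functions on a bounded set. -/
theorem norm_testToLp_le (hn : 1 ≤ n) {R : ℝ} (hR : 0 ≤ R) (hΩ : ∀ x ∈ Ω, ‖x‖ ≤ R)
    (φ : testFunctions Ω) : ‖testToLp Ω φ‖ ≤ 2 * R * ‖testGradient Ω φ‖ := by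
  obtain ⟨φ, hφ⟩ := φ
  refine le_of_sq_le_sq ?_ (by positivity)
  change ‖hφ.memLp.toLp φ‖ ^ 2 ≤ (2 * R * ‖hφ.memLp_gradient.toLp (gradient φ)‖) ^ 2
  rw [mul_pow, hφ.memLp.norm_toLp_sq, hφ.memLp_gradient.norm_toLp_sq,
    setIntegral_eq_integral_of_forall_compl_eq_zero
      fun x hx => by simp [hφ.eq_zero_of_notMem hx],
    setIntegral_eq_integral_of_forall_compl_eq_zero
      fun x hx => by simp [hφ.gradient_eq_zero_of_notMem hx]]
  have := hφ.integral_sq_le hn hΩ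
  simp only [Real.norm_eq_abs, sq_abs]
  linarith

theorem exists_testToLp_ne_zero (hΩ : IsOpen Ω) (hne : Ω.Nonempty) :
    ∃ φ, testToLp Ω φ ≠ 0 := by
  obtain ⟨x, hx⟩ := hne
  obtain ⟨φ, h1, h2, h3, -, h4⟩ := exists_contDiff_tsupport_subset (n := ⊤) (hΩ.mem_nhds hx)
  have hφ : IsTestFunction Ω φ := ⟨h3, h2, h1⟩
  refine ⟨⟨φ, hφ⟩, fun h0 => ?_⟩
  have h5 : φ =ᵐ[volume.restrict Ω] 0 := by
    have := (MemLp.toLp_eq_toLp_iff hφ.memLp (MemLp.zero (ε := ℝ))).mp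
      (h0.trans (MemLp.toLp_zero _).symm)
    exact this
  have h6 := Measure.eqOn_open_of_ae_eq h5 hΩ hφ.continuous.continuousOn continuousOn_const hx
  simp [h4] at h6

end

/-! ### Weak compactness and translation estimates -/

section

theorem eLpNorm_two_sq_eq_lintegral {α F : Type*} [MeasurableSpace α] {μ : Measure α}
    [NormedAddCommGroup F] (f : α → F) : eLpNorm f 2 μ ^ 2 = ∫⁻ x, ‖f x‖ₑ ^ 2 ∂μ := by
  have := eLpNorm_nnreal_pow_eq_lintegral (f := f) (μ := μ) (p := 2) two_ne_zero
  simpa using this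

theorem lintegral_sq_le_lintegral_sq {α : Type*} [MeasurableSpace α] {μ : Measure α}
    [IsProbabilityMeasure μ] {f : α → ENNReal} (hf : AEMeasurable f μ) :
    (∫⁻ x, f x ∂μ) ^ 2 ≤ ∫⁻ x, f x ^ 2 ∂μ := by
  have h := ENNReal.lintegral_mul_le_Lp_mul_Lq μ Real.HolderConjugate.two_two hf
    (aemeasurable_const (b := (1 : ENNReal)))
  simp only [Pi.mul_apply, mul_one, lintegral_const, measure_univ,
    ENNReal.rpow_two, one_pow, ENNReal.one_rpow] at h
  calc (∫⁻ x, f x ∂μ) ^ 2 ≤ ((∫⁻ x, f x ^ 2 ∂μ) ^ (1 / 2 : ℝ)) ^ 2 := by gcongr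
    _ = _ := by rw [← ENNReal.rpow_two, ← ENNReal.rpow_mul]; norm_num

/-- Sequential Banach–Alaoglu in the dual, where separability gives sequential compactness, carried
back by the Riesz isomorphism. -/
theorem exists_subseq_tendsto_inner {X : Type*} [NormedAddCommGroup X] [InnerProductSpace ℝ X]
    [CompleteSpace X] [TopologicalSpace.SeparableSpace X] {f : ℕ → X} {M : ℝ}
    (hf : ∀ k, ‖f k‖ ≤ M) :
    ∃ (σ : ℕ → ℕ) (f₀ : X), StrictMono σ ∧
      ∀ y, Tendsto (fun k => inner ℝ y (f (σ k))) atTop (𝓝 (inner ℝ y f₀)) := by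
  obtain ⟨w, -, σ, hσ, hw⟩ := WeakDual.isSeqCompact_closedBall ℝ X 0 M
    (x := fun k => StrongDual.toWeakDual (InnerProductSpace.toDual ℝ X (f k)))
    (fun k => by simpa using hf k)
  refine ⟨σ, (InnerProductSpace.toDual ℝ X).symm (WeakDual.toStrongDual w), hσ, fun y => ?_⟩
  rw [tendsto_iff_forall_eval_tendsto_topDualPairing] at hw
  have := hw y
  rw [real_inner_comm, InnerProductSpace.toDual_symm_apply]
  refine this.congr fun k => ?_
  rw [real_inner_comm]
  rfl

theorem cauchySeq_of_forall_exists_tendsto_dist_le {X : Type*} [PseudoMetricSpace X] {f : ℕ → X}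
    (h : ∀ ε > 0, ∃ (s : ℕ → X) (a : X), Tendsto s atTop (𝓝 a) ∧ ∀ k, dist (f k) (s k) ≤ ε) :
    CauchySeq f := by
  rw [Metric.cauchySeq_iff]
  intro ε hε
  obtain ⟨s, a, hs, hd⟩ := h (ε / 4) (by positivity)
  obtain ⟨N, hN⟩ := Metric.cauchySeq_iff.mp hs.cauchySeq (ε / 4) (by positivity)
  refine ⟨N, fun k hk l hl => ?_⟩
  have h1 := dist_triangle4 (f k) (s k) (s l) (f l)
  have h2 := hN k hk l hl
  have h3 := hd k
  have h4 := hd l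
  rw [dist_comm] at h4
  linarith

variable {n : ℕ} {Ω : Set (EuclideanSpace ℝ (Fin n))} {φ : EuclideanSpace ℝ (Fin n) → ℝ}

namespace IsTestFunction

/-- The fundamental theorem of calculus along the segment from `x` to `x + h`, then Cauchy–Schwarz
in `t`. -/
theorem enorm_sub_sq_le (hφ : IsTestFunction Ω φ) (x h : EuclideanSpace ℝ (Fin n)) :
    ‖φ (x + h) - φ x‖ₑ ^ 2 ≤
      ‖h‖ₑ ^ 2 * ∫⁻ t in Set.Ioc (0 : ℝ) 1, ‖gradient φ (x + t • h)‖ₑ ^ 2 := by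
  have hc : Continuous fun t : ℝ => gradient φ (x + t • h) :=
    hφ.continuous_gradient.comp (by fun_prop)
  have hd : ∀ t : ℝ, HasDerivAt (fun t : ℝ => φ (x + t • h))
      (inner ℝ (gradient φ (x + t • h)) h) t := by
    intro t
    rw [inner_gradient_left]
    have h1 : HasDerivAt (fun t : ℝ => x + t • h) h t := by
      simpa using ((hasDerivAt_id t).smul_const h).const_add x
    exact (hφ.differentiable (x + t • h)).hasFDerivAt.comp_hasDerivAt t h1
  have hc' : Continuous fun t : ℝ => (inner ℝ (gradient φ (x + t • h)) h : ℝ) :=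
    hc.inner (𝕜 := ℝ) continuous_const
  have e : φ (x + h) - φ x = ∫ t in Set.Ioc (0 : ℝ) 1, inner ℝ (gradient φ (x + t • h)) h := by
    have := intervalIntegral.integral_eq_sub_of_hasDerivAt (a := 0) (b := 1) (fun t _ => hd t)
      (hc'.intervalIntegrable 0 1)
    rw [intervalIntegral.integral_of_le zero_le_one] at this
    simpa using this.symm
  have : IsProbabilityMeasure (volume.restrict (Set.Ioc (0 : ℝ) 1)) := ⟨by simp⟩
  rw [e]
  calc _ ≤ (∫⁻ t in Set.Ioc (0 : ℝ) 1, ‖(inner ℝ (gradient φ (x + t • h)) h : ℝ)‖ₑ) ^ 2 := by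
        gcongr; exact enorm_integral_le_lintegral_enorm _
    _ ≤ ∫⁻ t in Set.Ioc (0 : ℝ) 1, ‖(inner ℝ (gradient φ (x + t • h)) h : ℝ)‖ₑ ^ 2 :=
        lintegral_sq_le_lintegral_sq hc'.measurable.enorm.aemeasurable
    _ ≤ ∫⁻ t in Set.Ioc (0 : ℝ) 1, ‖h‖ₑ ^ 2 * ‖gradient φ (x + t • h)‖ₑ ^ 2 := by
        refine lintegral_mono fun t => ?_
        rw [← mul_pow, mul_comm]
        gcongr
        rw [← ofReal_norm, ← ofReal_norm, ← ofReal_norm,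
          ← ENNReal.ofReal_mul (norm_nonneg _)]
        exact ENNReal.ofReal_le_ofReal (norm_inner_le_norm _ _)
    _ = _ := lintegral_const_mul _ (hc.measurable.enorm.pow_const 2)

/-- After Tonelli, translation invariance makes the inner integral independent of `t`. -/
theorem lintegral_enorm_sub_sq_le (hφ : IsTestFunction Ω φ) (h : EuclideanSpace ℝ (Fin n)) :
    ∫⁻ x, ‖φ (x + h) - φ x‖ₑ ^ 2 ≤ ‖h‖ₑ ^ 2 * ∫⁻ x, ‖gradient φ x‖ₑ ^ 2 := by
  have hm : Measurable fun q : EuclideanSpace ℝ (Fin n) × ℝ =>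
      ‖gradient φ (q.1 + q.2 • h)‖ₑ ^ 2 :=
    (hφ.continuous_gradient.comp (by fun_prop)).measurable.enorm.pow_const 2
  calc _ ≤ ∫⁻ x, ‖h‖ₑ ^ 2 * ∫⁻ t in Set.Ioc (0 : ℝ) 1, ‖gradient φ (x + t • h)‖ₑ ^ 2 :=
        lintegral_mono fun x => hφ.enorm_sub_sq_le x h
    _ = ‖h‖ₑ ^ 2 * ∫⁻ x, ∫⁻ t in Set.Ioc (0 : ℝ) 1, ‖gradient φ (x + t • h)‖ₑ ^ 2 :=
        lintegral_const_mul _ hm.lintegral_prod_right'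
    _ = ‖h‖ₑ ^ 2 * ∫⁻ t in Set.Ioc (0 : ℝ) 1, ∫⁻ x, ‖gradient φ (x + t • h)‖ₑ ^ 2 := by
        rw [lintegral_lintegral_swap hm.aemeasurable]
    _ = _ := by
        simp only [fun t : ℝ => lintegral_add_right_eq_self (μ := volume)
          (fun x => ‖gradient φ x‖ₑ ^ 2) (t • h)]
        simp

/-- Jensen's inequality bounds the squared error by the `ν`-average of squared translation
differences, each controlled by the gradient. -/
theorem eLpNorm_sub_integral_translate_le (hφ : IsTestFunction Ω φ)
    {ν : Measure (EuclideanSpace ℝ (Fin n))} [IsProbabilityMeasure ν] {r : ℝ}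
    (hν : ∀ᵐ h ∂ν, ‖h‖ ≤ r) :
    eLpNorm (fun x => φ x - ∫ h, φ (x + h) ∂ν) 2 volume ≤
      ENNReal.ofReal r * eLpNorm (gradient φ) 2 volume := by
  have hm : Measurable fun q : EuclideanSpace ℝ (Fin n) × EuclideanSpace ℝ (Fin n) =>
      ‖φ (q.1 + q.2) - φ q.1‖ₑ ^ 2 :=
    ((hφ.continuous.comp (by fun_prop)).sub
      (hφ.continuous.comp continuous_fst)).measurable.enorm.pow_const 2
  obtain ⟨B, hB⟩ := hφ.compact_supp.exists_bound_of_continuous hφ.continuous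
  have hi : ∀ x, Integrable (fun h => φ (x + h)) ν := fun x =>
    Integrable.of_bound (hφ.continuous.comp (by fun_prop)).aestronglyMeasurable B
      (ae_of_all _ fun h => hB _)
  have hpt : ∀ x, ‖φ x - ∫ h, φ (x + h) ∂ν‖ₑ ^ 2 ≤ ∫⁻ h, ‖φ (x + h) - φ x‖ₑ ^ 2 ∂ν := by
    intro x
    have e : ∫ h, (φ (x + h) - φ x) ∂ν = (∫ h, φ (x + h) ∂ν) - φ x := by
      rw [integral_sub (hi x) (integrable_const _)]; simp
    rw [← enorm_neg, neg_sub, ← e]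
    calc _ ≤ (∫⁻ h, ‖φ (x + h) - φ x‖ₑ ∂ν) ^ 2 := by
          gcongr; exact enorm_integral_le_lintegral_enorm _
      _ ≤ _ := lintegral_sq_le_lintegral_sq
          ((hφ.continuous.comp (by fun_prop)).sub continuous_const).measurable.enorm.aemeasurable
  refine (ENNReal.pow_le_pow_left_iff two_ne_zero).mp ?_
  rw [mul_pow, eLpNorm_two_sq_eq_lintegral, eLpNorm_two_sq_eq_lintegral]
  calc _ ≤ ∫⁻ x, ∫⁻ h, ‖φ (x + h) - φ x‖ₑ ^ 2 ∂ν := lintegral_mono hpt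
    _ = ∫⁻ h, ∫⁻ x, ‖φ (x + h) - φ x‖ₑ ^ 2 ∂volume ∂ν :=
        lintegral_lintegral_swap hm.aemeasurable
    _ ≤ ∫⁻ _, (ENNReal.ofReal r ^ 2 * ∫⁻ x, ‖gradient φ x‖ₑ ^ 2) ∂ν := by
        refine lintegral_mono_ae ?_
        filter_upwards [hν] with h hh
        refine (hφ.lintegral_enorm_sub_sq_le h).trans ?_
        gcongr
        rw [← ofReal_norm]
        exact ENNReal.ofReal_le_ofReal hh
    _ = _ := by simp

end IsTestFunction

end

/-! ### Ball averages and Rellich's theorem -/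

section

variable {n : ℕ} {Ω : Set (EuclideanSpace ℝ (Fin n))}

theorem memLp_indicator_ball (Ω : Set (EuclideanSpace ℝ (Fin n))) (x : EuclideanSpace ℝ (Fin n))
    (r : ℝ) : MemLp ((Metric.ball x r).indicator fun _ => (1 : ℝ)) 2 (volume.restrict Ω) :=
  (memLp_indicator_const 2 Metric.isOpen_ball.measurableSet 1
    (Or.inr (measure_ball_lt_top).ne)).restrict Ω

/-- The indicator function of a ball as an element of `L²(Ω)`. -/
noncomputable def ballIndicatorLp (Ω : Set (EuclideanSpace ℝ (Fin n))) (r : ℝ)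
    (x : EuclideanSpace ℝ (Fin n)) : Lp ℝ 2 (volume.restrict Ω) :=
  (memLp_indicator_ball Ω x r).toLp _

theorem norm_ballIndicatorLp_sq_le (hΩ : volume Ω ≠ ⊤) (r : ℝ) (x : EuclideanSpace ℝ (Fin n)) :
    ‖ballIndicatorLp Ω r x‖ ^ 2 ≤ volume.real Ω := by
  have : IsFiniteMeasure (volume.restrict Ω) := isFiniteMeasure_restrict.mpr hΩ
  rw [ballIndicatorLp, MemLp.norm_toLp_sq]
  calc _ ≤ ∫ _ in Ω, (1 : ℝ) := by
        refine integral_mono_of_nonneg (ae_of_all _ fun y => by positivity) (integrable_const _)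
          (ae_of_all _ fun y => ?_)
        by_cases hy : y ∈ Metric.ball x r <;> simp [hy]
    _ = _ := by simp

/-- The uniform probability measure on a ball around the origin. -/
noncomputable def ballMeasure (n : ℕ) (r : ℝ) : Measure (EuclideanSpace ℝ (Fin n)) :=
  ProbabilityTheory.cond volume (Metric.ball 0 r)

theorem isProbabilityMeasure_ballMeasure {r : ℝ} (hr : 0 < r) :
    IsProbabilityMeasure (ballMeasure n r) :=
  ProbabilityTheory.cond_isProbabilityMeasure_of_finite (Metric.measure_ball_pos _ _ hr).ne'
    measure_ball_lt_top.ne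

theorem ae_ballMeasure_norm_le (r : ℝ) : ∀ᵐ h ∂(ballMeasure n r), ‖h‖ ≤ r := by
  refine Measure.ae_smul_measure ?_ _
  filter_upwards [ae_restrict_mem Metric.isOpen_ball.measurableSet] with h hh
  exact (mem_ball_zero_iff.mp hh).le

/-- Writing the average at `x` as a pairing with a fixed `L²` element lets weak convergence give
pointwise convergence of averages. The ball may leave `Ω`, where `φ` vanishes. -/
theorem integral_ballMeasure_translate (r : ℝ) (φ : testFunctions Ω)
    (x : EuclideanSpace ℝ (Fin n)) :
    ∫ h, φ.1 (x + h) ∂(ballMeasure n r) =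
      (volume (Metric.ball (0 : EuclideanSpace ℝ (Fin n)) r))⁻¹.toReal *
        inner ℝ (ballIndicatorLp Ω r x) (testToLp Ω φ) := by
  have hφ := φ.2
  change _ = _ * inner ℝ ((memLp_indicator_ball Ω x r).toLp _) (hφ.memLp.toLp φ.1)
  rw [MemLp.inner_toLp_toLp, ballMeasure, ProbabilityTheory.cond, integral_smul_measure,
    smul_eq_mul]
  congr 1
  rw [setIntegral_eq_integral_of_forall_compl_eq_zero (s := Ω)
      fun y hy => by rw [hφ.eq_zero_of_notMem hy, inner_zero_right],
    ← integral_indicator Metric.isOpen_ball.measurableSet,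
    ← integral_add_left_eq_self (fun y => inner ℝ _ (φ.1 y)) x]
  refine integral_congr_ae (ae_of_all _ fun h => ?_)
  by_cases hh : ‖h‖ < r <;> simp [Set.indicator, hh]

theorem memLp_ballAverage (hΩ : volume Ω ≠ ⊤) (r : ℝ) (φ : testFunctions Ω) :
    MemLp (fun x => ∫ h, φ.1 (x + h) ∂(ballMeasure n r)) 2 (volume.restrict Ω) := by
  have : IsFiniteMeasure (volume.restrict Ω) := isFiniteMeasure_restrict.mpr hΩ
  have : SFinite (ballMeasure n r) := by unfold ballMeasure; infer_instance
  refine MemLp.of_bound ?_ ((volume (Metric.ball (0 : EuclideanSpace ℝ (Fin n)) r))⁻¹.toReal *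
    (√(volume.real Ω) * ‖testToLp Ω φ‖)) (ae_of_all _ fun x => ?_)
  · have hc : Continuous fun q : EuclideanSpace ℝ (Fin n) × EuclideanSpace ℝ (Fin n) =>
        φ.1 (q.1 + q.2) := φ.2.continuous.comp (by fun_prop)
    exact (hc.stronglyMeasurable.integral_prod_right').aestronglyMeasurable
  · rw [integral_ballMeasure_translate, norm_mul, Real.norm_of_nonneg ENNReal.toReal_nonneg]
    gcongr
    refine (norm_inner_le_norm _ _).trans ?_
    gcongr
    exact Real.le_sqrt_of_sq_le (norm_ballIndicatorLp_sq_le hΩ r x)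

theorem dist_testToLp_ballAverage_le (hΩ : volume Ω ≠ ⊤) {r : ℝ} (hr : 0 < r)
    (φ : testFunctions Ω) :
    dist (testToLp Ω φ) ((memLp_ballAverage hΩ r φ).toLp _) ≤ r * ‖testGradient Ω φ‖ := by
  have hφ := φ.2
  have := isProbabilityMeasure_ballMeasure (n := n) hr
  change dist (hφ.memLp.toLp φ.1) _ ≤ r * ‖hφ.memLp_gradient.toLp (gradient φ.1)‖
  have h0 : eLpNorm (gradient φ.1) 2 volume = eLpNorm (gradient φ.1) 2 (volume.restrict Ω) := by
    refine (eLpNorm_restrict_eq_of_support_subset ?_).symm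
    intro x hx
    by_contra h
    exact hx (hφ.gradient_eq_zero_of_notMem h)
  rw [dist_eq_norm, ← MemLp.toLp_sub, Lp.norm_toLp, Lp.norm_toLp, ← ENNReal.toReal_ofReal hr.le,
    ← ENNReal.toReal_mul, ENNReal.toReal_ofReal hr.le, ← h0]
  refine ENNReal.toReal_mono (ENNReal.mul_ne_top ENNReal.ofReal_ne_top ?_) ?_
  · rw [h0]; exact hφ.memLp_gradient.2.ne
  · exact (eLpNorm_mono_measure _ Measure.restrict_le_self).trans
      (hφ.eLpNorm_sub_integral_translate_le (ae_ballMeasure_norm_le r))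

/-- The averages converge pointwise and are uniformly bounded, so dominated convergence on the
finite measure space gives convergence in `L²`. -/
theorem exists_tendsto_toLp_ballAverage (hΩ : volume Ω ≠ ⊤) (r : ℝ) {φ : ℕ → testFunctions Ω}
    {M : ℝ} (hM : ∀ k, ‖testToLp Ω (φ k)‖ ≤ M) {f : Lp ℝ 2 (volume.restrict Ω)}
    (hf : ∀ y, Tendsto (fun k => inner ℝ y (testToLp Ω (φ k))) atTop (𝓝 (inner ℝ y f))) :
    ∃ a, Tendsto (fun k => (memLp_ballAverage hΩ r (φ k)).toLp _) atTop (𝓝 a) := by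
  have : IsFiniteMeasure (volume.restrict Ω) := isFiniteMeasure_restrict.mpr hΩ
  have hM0 : 0 ≤ M := (norm_nonneg _).trans (hM 0)
  set c := (volume (Metric.ball (0 : EuclideanSpace ℝ (Fin n)) r))⁻¹.toReal with hc
  have hc0 : 0 ≤ c := ENNReal.toReal_nonneg
  set A : ℕ → EuclideanSpace ℝ (Fin n) → ℝ := fun k x => ∫ h, (φ k).1 (x + h) ∂(ballMeasure n r)
  have hA : ∀ k, MemLp (A k) 2 (volume.restrict Ω) := fun k => memLp_ballAverage hΩ r (φ k)
  set a : EuclideanSpace ℝ (Fin n) → ℝ := fun x => c * inner ℝ (ballIndicatorLp Ω r x) f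
  have hlim : ∀ x, Tendsto (fun k => A k x) atTop (𝓝 (a x)) := by
    intro x
    simp only [A, integral_ballMeasure_translate]
    exact (hf _).const_mul c
  set K := c * (√(volume.real Ω) * M) with hK
  have hAK : ∀ k x, ‖A k x‖ ≤ K := by
    intro k x
    simp only [A, integral_ballMeasure_translate]
    rw [norm_mul, Real.norm_of_nonneg hc0, hK]
    gcongr
    refine (norm_inner_le_norm _ _).trans ?_
    gcongr
    · exact Real.le_sqrt_of_sq_le (norm_ballIndicatorLp_sq_le hΩ r x)
    · exact hM k
  have haK : ∀ x, ‖a x‖ ≤ K := fun x =>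
    le_of_tendsto' (hlim x).norm fun k => hAK k x
  have ha : MemLp a 2 (volume.restrict Ω) :=
    MemLp.of_bound (aestronglyMeasurable_of_tendsto_ae atTop (fun k => (hA k).1)
      (ae_of_all _ hlim)) K (ae_of_all _ haK)
  refine ⟨ha.toLp a, ?_⟩
  rw [tendsto_iff_norm_sub_tendsto_zero]
  have h2 : Tendsto (fun k => ‖(hA k).toLp _ - ha.toLp a‖ ^ 2) atTop (𝓝 0) := by
    have e : ∀ k, ‖(hA k).toLp _ - ha.toLp a‖ ^ 2 =
        ∫ x in Ω, ‖A k x - a x‖ ^ 2 := fun k => by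
      rw [← MemLp.toLp_sub, MemLp.norm_toLp_sq]
      rfl
    simp only [e]
    have := tendsto_integral_of_dominated_convergence (μ := volume.restrict Ω)
      (F := fun k x => ‖A k x - a x‖ ^ 2) (f := fun _ => 0) (fun _ => (K + K) ^ 2)
      (fun k => ((hA k).1.sub ha.1).norm.pow 2) (integrable_const _)
      (fun k => ae_of_all _ fun x => ?_) (ae_of_all _ fun x => ?_)
    · simpa using this
    · rw [norm_pow, norm_norm]
      gcongr
      exact (norm_sub_le _ _).trans (add_le_add (hAK k x) (haK x))
    · simpa using ((hlim x).sub_const (a x)).norm.pow 2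
  simpa [Real.sqrt_sq] using h2.sqrt

/-- **Rellich's theorem**: a sequence of test functions bounded in `H¹` has a subsequence
converging in `L²`. -/
theorem exists_subseq_tendsto_testToLp (hΩ : volume Ω ≠ ⊤) {φ : ℕ → testFunctions Ω} {M N : ℝ}
    (hM : ∀ k, ‖testToLp Ω (φ k)‖ ≤ M) (hN : ∀ k, ‖testGradient Ω (φ k)‖ ≤ N) :
    ∃ σ : ℕ → ℕ, StrictMono σ ∧ ∃ x, Tendsto (fun k => testToLp Ω (φ (σ k))) atTop (𝓝 x) := by
  have : Fact ((2 : ENNReal) ≠ ⊤) := ⟨by simp⟩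
  obtain ⟨σ, f, hσ, hf⟩ := exists_subseq_tendsto_inner hM
  refine ⟨σ, hσ, cauchySeq_tendsto_of_complete
    (cauchySeq_of_forall_exists_tendsto_dist_le fun ε hε => ?_)⟩
  have hN0 : 0 ≤ N := (norm_nonneg _).trans (hN 0)
  -- With this radius the averaging error is at most `ε * N / (N + 1) ≤ ε`, also when `N = 0`.
  have hr : 0 < ε / (N + 1) := by positivity
  obtain ⟨a, ha⟩ := exists_tendsto_toLp_ballAverage hΩ (ε / (N + 1)) (fun k => hM (σ k)) hf
  refine ⟨_, a, ha, fun k => (dist_testToLp_ballAverage_le hΩ hr _).trans ?_⟩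
  rw [div_mul_eq_mul_div, div_le_iff₀ (by positivity)]
  have := hN (σ k)
  gcongr
  linarith

end

/-! ### The first eigenvalue and the bound for positive solutions -/

section

variable {n : ℕ} {Ω : Set (EuclideanSpace ℝ (Fin n))}

theorem isH10_coeFn_of_tendsto {x : Lp ℝ 2 (volume.restrict Ω)}
    {y : Lp (EuclideanSpace ℝ (Fin n)) 2 (volume.restrict Ω)} {φ : ℕ → testFunctions Ω}
    (h1 : Tendsto (fun k => testToLp Ω (φ k)) atTop (𝓝 x))
    (h2 : Tendsto (fun k => testGradient Ω (φ k)) atTop (𝓝 y)) : IsH10 Ω x y :=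
  isH10_of_tendsto (Lp.memLp x) (Lp.memLp y) (by rwa [Lp.toLp_coeFn]) (by rwa [Lp.toLp_coeFn])

/-- On a bounded open set the Rayleigh quotient attains a positive minimum over `H₀¹`, at a weak
eigenfunction. -/
theorem exists_eigenvalue_rayleigh (hn : 1 ≤ n) (hΩ_open : IsOpen Ω) (hΩ_nonempty : Ω.Nonempty)
    (hΩ_bounded : Bornology.IsBounded Ω) :
    ∃ lam : ℝ, 0 < lam ∧ IsDirichletEigenvalue Ω lam ∧
      ∀ u g, IsH10 Ω u g → lam * ∫ x in Ω, u x * u x ≤ ∫ x in Ω, inner ℝ (g x) (g x) := by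
  have hfin : volume Ω ≠ ⊤ := hΩ_bounded.measure_lt_top.ne
  obtain ⟨R, hR, hΩR⟩ := hΩ_bounded.exists_pos_norm_le
  have hP := norm_testToLp_le hn hR.le hΩR
  obtain ⟨lam, hlam, hray, φ, x, y, hx, hy, hx1, hEL⟩ :=
    exists_rayleigh_minimizer (testToLp Ω) (testGradient Ω) (C := 2 * R) (by positivity) hP
      (exists_testToLp_ne_zero hΩ_open hΩ_nonempty) fun v M hM =>
        exists_subseq_tendsto_testToLp hfin (M := 2 * R * M)
          (fun k => (hP (v k)).trans (by have := hM k; gcongr)) hM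
  refine ⟨lam, hlam, ⟨x, y, isH10_coeFn_of_tendsto hx hy, fun h0 => ?_, fun v h hv => ?_⟩,
    fun u g hu => ?_⟩
  · rw [Lp.eq_zero_iff_ae_eq_zero.mpr h0, norm_zero] at hx1
    exact zero_ne_one hx1
  -- The Euler–Lagrange equation holds against test functions; both sides are continuous in the `H¹`
  -- norm, so it extends to `v`.
  · obtain ⟨ψ, h1, h2⟩ := hv.exists_testFunctions_tendsto
    have key := tendsto_nhds_unique ((tendsto_const_nhds (x := y)).inner (𝕜 := ℝ) h2)
      ((((tendsto_const_nhds (x := x)).inner (𝕜 := ℝ) h1).const_mul lam).congr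
        fun k => (hEL (ψ k)).symm)
    rw [← Lp.toLp_coeFn x (Lp.memLp x), ← Lp.toLp_coeFn y (Lp.memLp y),
      MemLp.inner_toLp_toLp, MemLp.inner_toLp_toLp] at key
    simpa [mul_comm] using key
  · obtain ⟨ψ, h1, h2⟩ := hu.exists_testFunctions_tendsto
    have key := le_of_tendsto_of_tendsto' ((h1.norm.pow 2).const_mul lam) (h2.norm.pow 2)
      fun k => hray (ψ k)
    rw [MemLp.norm_toLp_sq, MemLp.norm_toLp_sq] at key
    simpa [← sq] using key

theorem integral_mul_self_pos {α : Type*} [MeasurableSpace α] {μ : Measure α} {u : α → ℝ}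
    (hu : MemLp u 2 μ) (h0 : ¬ u =ᵐ[μ] 0) : 0 < ∫ x, u x * u x ∂μ := by
  have hi : Integrable (fun x => u x * u x) μ := hu.integrable_mul hu
  refine lt_of_le_of_ne (integral_nonneg fun x => mul_self_nonneg _) fun h => h0 ?_
  filter_upwards [(integral_eq_zero_iff_of_nonneg (fun x => mul_self_nonneg (u x)) hi).mp h.symm]
    with x hx
  simpa using hx

end

theorem lemma1 (n : ℕ) (hn : 1 ≤ n) (Ω : Set (EuclideanSpace ℝ (Fin n)))
    (hΩ_open : IsOpen Ω) (hΩ_nonempty : Ω.Nonempty) (hΩ_bounded : Bornology.IsBounded Ω) :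
    IsLeast {lam : ℝ | IsDirichletEigenvalue Ω lam} (firstDirichletEigenvalue Ω) ∧
      0 < firstDirichletEigenvalue Ω ∧
      ∀ (p : ℝ) (u : EuclideanSpace ℝ (Fin n) → ℝ), IsPositiveWeakSolution Ω p u →
        (firstDirichletEigenvalue Ω : EReal) ≤
          essSup (fun x => ((u x ^ (p - 1) : ℝ) : EReal)) (volume.restrict Ω) := by
  obtain ⟨lam, hlam, heig, hray⟩ :=
    exists_eigenvalue_rayleigh hn hΩ_open hΩ_nonempty hΩ_bounded
  have hleast : IsLeast {lam : ℝ | IsDirichletEigenvalue Ω lam} lam := by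
    refine ⟨heig, ?_⟩
    rintro mu ⟨u, g, hu, hu0, h⟩
    have h1 := hray u g hu
    rw [h u g hu] at h1
    exact le_of_mul_le_mul_right h1 (integral_mul_self_pos hu.isH1.memLp hu0)
  have hfirst : firstDirichletEigenvalue Ω = lam := hleast.csInf_eq
  rw [hfirst]
  refine ⟨hleast, hlam, fun p u ⟨hpos, g, hu, hsol⟩ => ?_⟩
  obtain ⟨hint, heq⟩ := hsol u g hu
  have hΩ0 : volume Ω ≠ 0 := (hΩ_open.measure_pos _ hΩ_nonempty).ne'
  -- Without positive measure, `u > 0` a.e. would not exclude `u = 0` a.e.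
  have : NeZero (volume.restrict Ω) := ⟨by simpa using hΩ0⟩
  have hu0 : ¬ u =ᵐ[volume.restrict Ω] 0 := fun h0 => by
    obtain ⟨x, h1, h2⟩ := (hpos.and h0).exists
    exact h1.ne' h2
  have hupos := integral_mul_self_pos hu.isH1.memLp hu0
  by_contra! hlt
  -- A real `q` strictly between turns the extended-real bound into a real a.e. bound, even if the
  -- essential supremum is not known to be finite.
  obtain ⟨q, hq1, hq2⟩ := EReal.exists_between_coe_real hlt
  have hle : ∀ᵐ x ∂(volume.restrict Ω), u x ^ p * u x ≤ q * (u x * u x) := by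
    filter_upwards [hpos, ae_lt_of_essSup_lt hq1] with x hx hx1
    have h1 : u x ^ (p - 1) ≤ q := (EReal.coe_lt_coe_iff.mp hx1).le
    have h2 : u x ^ p = u x ^ (p - 1) * u x := by
      rw [Real.rpow_sub_one hx.ne', div_mul_cancel₀ _ hx.ne']
    rw [h2, mul_assoc]
    gcongr
  have h1 := integral_mono_ae hint ((hu.isH1.memLp.integrable_mul hu.isH1.memLp).const_mul q) hle
  have h2 := hray u g hu
  rw [heq] at h2
  have h3 := h2.trans h1
  simp only [Pi.mul_apply, integral_const_mul] at h3
  exact (EReal.coe_lt_coe_iff.mp hq2).not_ge (le_of_mul_le_mul_right h3 hupos)
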